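/- Let $R$ be an associative ring with identity and let $M$ be a unital $R$-module with injective hull $E(M)$. Suppose that $M$ is automorphism-invariant, that is, $g(M)\subseteq M$ for every automorphism $g$ of $E(M)$. Then the following conditions are equivalent: (i) $M$ is directly finite, that is, $M$ is not isomorphic to a proper direct summand of itself. (ii) $M$ has the internal cancellation property: whenever $M=A_1\oplus B_1\cong A_2\oplus B_2$ with $A_1\cong A_2$, then $B_1\cong B_2$. (iii) $M$ has the cancellation property: for all $R$-modules $A$ and $B$, if $M\oplus A\cong M\oplus B$, then $A\cong B$. (iv) $M$ has the substitution property: for every $R$-module $X$ with decompositions $X=A_1\oplus H=A_2\oplus K$ such that $A_1\cong M\cong A_2$, there exists a submodule $C$ of $X$ such that $X=C\oplus H=C\oplus K$. -/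

import Mathlib

universe u v w

/-- `N` is an essential submodule of `M`: it meets every nonzero submodule nontrivially. -/
def IsEssentialSubmodule {R : Type u} [Ring R] {M : Type v} [AddCommGroup M] [Module R M]
    (N : Submodule R M) : Prop :=
  ∀ K : Submodule R M, N ⊓ K = ⊥ → K = ⊥

/-- `ι : M → E` exhibits `E` as an injective hull of `M`: the module `E` is injective, and `ι`
is injective with essential image. -/
structure IsInjectiveHull {R : Type u} [Ring R] {M : Type v} [AddCommGroup M] [Module R M]
    {E : Type w} [AddCommGroup E] [Module R E] (ι : M →ₗ[R] E) : Prop where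
  moduleInjective : Module.Injective R E
  injective : Function.Injective ι
  essential : IsEssentialSubmodule (LinearMap.range ι)

/-- Every module has an injective hull, in the universe used in `IsAutomorphismInvariant`. -/
theorem exists_isInjectiveHull (R : Type u) [Ring R] (M : Type v) [AddCommGroup M] [Module R M] :
    ∃ (E : Type (max u v)) (_ : AddCommGroup E) (_ : Module R E) (ι : M →ₗ[R] E),
      IsInjectiveHull ι := by
  classical
  -- an injective module `I` containing `M`
  obtain ⟨I, _, _, hI, f, hf⟩ : ∃ (I : Type (max u v)) (_ : AddCommGroup I) (_ : Module R I)
      (_ : Module.Injective R I) (f : M →ₗ[R] I), Function.Injective f := by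
    let X : ModuleCat.{max u v} R := ModuleCat.of R (ULift.{u} M)
    let J := CategoryTheory.Injective.under X
    have hJ : Module.Injective R J :=
      Module.injective_module_of_injective_object (inj := inferInstanceAs
        (CategoryTheory.Injective J))
    refine ⟨J, inferInstance, inferInstance, hJ,
      (CategoryTheory.Injective.ι X).hom ∘ₗ (ULift.moduleEquiv (R := R) (M := M)).symm.toLinearMap,
      ?_⟩
    have h1 := (ModuleCat.mono_iff_injective (CategoryTheory.Injective.ι X)).mp inferInstance
    exact h1.comp (ULift.moduleEquiv (R := R) (M := M)).symm.injective
  let P := LinearMap.range f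
  -- a maximal essential extension `E` of the image `P` of `M` inside `I`
  obtain ⟨E, -, ⟨hPE, hE⟩, hEmax⟩ := zorn_le_nonempty₀
    {E : Submodule R I | P ≤ E ∧ ∀ N ≤ E, P ⊓ N = ⊥ → N = ⊥} (by
      intro c hc hchain y hy
      refine ⟨sSup c, ⟨(hc hy).1.trans (le_sSup hy), fun N hN hPN => ?_⟩, fun z hz => le_sSup hz⟩
      rw [eq_bot_iff]
      intro x hx
      obtain ⟨F, hF, hxF⟩ := (Submodule.mem_sSup_of_directed ⟨y, hy⟩ hchain.directedOn).mp (hN hx)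
      have h1 : Submodule.span R {x} ≤ F := by simpa using hxF
      have h2 : Submodule.span R {x} ≤ N := by simpa using hx
      have h3 := (hc hF).2 _ h1 (eq_bot_iff.mpr ((inf_le_inf_left P h2).trans hPN.le))
      simpa using h3) P ⟨le_rfl, fun N hN h => by rwa [inf_eq_right.mpr hN] at h⟩
  -- a submodule `K` maximal with `E ⊓ K = ⊥`
  obtain ⟨K, -, hK, hKmax⟩ := zorn_le_nonempty₀ {K : Submodule R I | E ⊓ K = ⊥} (by
      intro c hc hchain y hy
      refine ⟨sSup c, ?_, fun z hz => le_sSup hz⟩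
      rw [Set.mem_ofPred_eq, eq_bot_iff]
      rintro x ⟨hxE, hx⟩
      obtain ⟨F, hF, hxF⟩ := (Submodule.mem_sSup_of_directed ⟨y, hy⟩ hchain.directedOn).mp hx
      exact (hc hF).le ⟨hxE, hxF⟩) ⊥ (by simp)
  simp only [Set.mem_ofPred_eq] at hK hKmax hEmax
  have hinj : Function.Injective (K.mkQ ∘ₗ E.subtype) := by
    rw [← LinearMap.ker_eq_bot, eq_bot_iff]
    rintro ⟨x, hxE⟩ hx
    have hxK : x ∈ K := by simpa using hx
    have : x ∈ (⊥ : Submodule R I) := hK.le ⟨hxE, hxK⟩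
    simpa using this
  obtain ⟨h, hh⟩ := Module.Injective.extension_property R I E (I ⧸ K) (K.mkQ ∘ₗ E.subtype) hinj
    E.subtype
  have hh' : ∀ e ∈ E, h (K.mkQ e) = e := fun e he => LinearMap.congr_fun hh ⟨e, he⟩
  have hEr : E ≤ LinearMap.range h := fun e he => ⟨_, hh' e he⟩
  have hrE : LinearMap.range h ≤ E := by
    refine hEmax ⟨hPE.trans hEr, fun N hN hPN => ?_⟩ hEr
    have hEN : E ⊓ N = ⊥ := hE _ inf_le_left
      (eq_bot_iff.mpr ((inf_le_inf_left P inf_le_right).trans hPN.le))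
    have hKN : (N.comap h).comap K.mkQ ≤ K := by
      refine hKmax ?_ ?_
      · rw [eq_bot_iff]
        rintro x ⟨hxE, hx⟩
        have hx' : h (K.mkQ x) ∈ N := hx
        rw [hh' x hxE] at hx'
        exact hEN.le ⟨hxE, hx'⟩
      · intro x hx
        have : K.mkQ x = 0 := by simpa using hx
        simp [Submodule.mem_comap, this]
    rw [eq_bot_iff]
    intro x hx
    obtain ⟨y, rfl⟩ := hN hx
    obtain ⟨z, rfl⟩ := K.mkQ_surjective y
    have hz : z ∈ K := hKN hx
    have : K.mkQ z = 0 := by simpa using hz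
    simp [this]
  let r : I →ₗ[R] E := (h ∘ₗ K.mkQ).codRestrict E (fun x => hrE ⟨_, rfl⟩)
  refine ⟨E, inferInstance, inferInstance, f.codRestrict E (fun x => hPE ⟨x, rfl⟩), ⟨?_⟩, ?_, ?_⟩
  · intro X Y _ _ _ _ i hi g
    obtain ⟨k, hk⟩ := hI.out i hi (E.subtype ∘ₗ g)
    refine ⟨r ∘ₗ k, fun x => Subtype.ext ?_⟩
    have : k (i x) = (g x : I) := hk x
    change h (K.mkQ (k (i x))) = _
    rw [this, hh' _ (g x).2]
  · intro x y hxy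
    exact hf (congrArg Subtype.val hxy)
  · intro N hN
    have h1 : N.map E.subtype = ⊥ := by
      refine hE _ (Submodule.map_subtype_le E N) ?_
      rw [eq_bot_iff]
      rintro _ ⟨⟨m, rfl⟩, ⟨n, hn, hnm⟩⟩
      have hnm' : (n : I) = f m := hnm
      have : n ∈ (⊥ : Submodule R E) := hN.le ⟨⟨m, Subtype.ext hnm'.symm⟩, hn⟩
      have hn0 : n = 0 := by simpa using this
      rw [← hnm', hn0]
      simp
    exact Submodule.map_injective_of_injective E.injective_subtype (by rw [h1, Submodule.map_bot])

/-- `M` is invariant under all automorphisms of its injective hull. The hull exists by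
`exists_isInjectiveHull` and is unique up to isomorphism over `M`, so the condition does not
depend on the choice of the hull. -/
def IsAutomorphismInvariant (R : Type u) [Ring R] (M : Type v) [AddCommGroup M] [Module R M] :
    Prop :=
  ∀ (E : Type (max u v)) [AddCommGroup E] [Module R E] (ι : M →ₗ[R] E), IsInjectiveHull ι →
    ∀ g : E ≃ₗ[R] E, (LinearMap.range ι).map g.toLinearMap ≤ LinearMap.range ι

/-- `M` is directly finite: it is not isomorphic to a proper direct summand of itself. -/
def IsDirectlyFinite (R : Type u) [Ring R] (M : Type v) [AddCommGroup M] [Module R M] : Prop :=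
  ∀ N K : Submodule R M, IsCompl N K → Nonempty (M ≃ₗ[R] N) → N = ⊤

/-- Internal cancellation: if `M = A₁ ⊕ B₁ ≅ A₂ ⊕ B₂` with `A₁ ≅ A₂`, then `B₁ ≅ B₂`. -/
def HasInternalCancellation (R : Type u) [Ring R] (M : Type v) [AddCommGroup M] [Module R M] :
    Prop :=
  ∀ (A₁ B₁ : Submodule R M), IsCompl A₁ B₁ →
    ∀ (A₂ B₂ : Type v) [AddCommGroup A₂] [Module R A₂] [AddCommGroup B₂] [Module R B₂],
      Nonempty (M ≃ₗ[R] A₂ × B₂) → Nonempty (A₁ ≃ₗ[R] A₂) → Nonempty (B₁ ≃ₗ[R] B₂)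

/-- Cancellation: if `M ⊕ A ≅ M ⊕ B`, then `A ≅ B`. Here `A` and `B` range over the modules in
any universe that is at least as large as that of `M`. -/
def HasCancellation (R : Type u) [Ring R] (M : Type v) [AddCommGroup M] [Module R M] : Prop :=
  ∀ (A B : Type (max v w)) [AddCommGroup A] [Module R A] [AddCommGroup B] [Module R B],
    Nonempty ((M × A) ≃ₗ[R] (M × B)) → Nonempty (A ≃ₗ[R] B)

/-- Substitution: if `X = A₁ ⊕ H = A₂ ⊕ K` with `A₁ ≅ M ≅ A₂`, then there is a submodule `C` of
`X` with `X = C ⊕ H = C ⊕ K`. Here `X` ranges over the modules in any universe that is at least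
as large as that of `M`. -/
def HasSubstitution (R : Type u) [Ring R] (M : Type v) [AddCommGroup M] [Module R M] : Prop :=
  ∀ (X : Type (max v w)) [AddCommGroup X] [Module R X] (A₁ H A₂ K : Submodule R X),
    IsCompl A₁ H → IsCompl A₂ K → Nonempty (A₁ ≃ₗ[R] M) → Nonempty (A₂ ≃ₗ[R] M) →
      ∃ C : Submodule R X, IsCompl C H ∧ IsCompl C K

/-! ### Essential submodules and maximal complements -/

section Essential

variable {R : Type u} [Ring R] {M : Type v} [AddCommGroup M] [Module R M]

/-! The content is that direct finiteness makes `End M` have stable range one, which yields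
substitution; the other implications are formal.

Let `E` be the injective hull. If `x` is a square-zero endomorphism of `E`, then `1 + x` is an
automorphism, so `x` restricts to `M`. Hence if a summand `A` of `E` has a disjoint copy in `E`, all
endomorphisms of `A`, being products of two square-zero maps, restrict to `M`. A non-surjective
injective `f` on `E` would produce such an `A` carrying a proper shift, and this would contradict
the direct finiteness of `M` (`surjective_of_injective_hull`).

So injective endomorphisms of `E` are bijective, and a maximality argument extends every partial
monomorphism of `E` to an automorphism (`exists_linearEquiv_eqOn`). Automorphisms of `E` restrict to
automorphisms of `M`, so `M` inherits this extension property. Stable range one follows by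
correcting `f` with an automorphism that agrees with it on a maximal complement of `ker f`. -/

theorem IsEssentialSubmodule.exists_smul_mem {N : Submodule R M} (hN : IsEssentialSubmodule N)
    {x : M} (hx : x ≠ 0) : ∃ r : R, r • x ∈ N ∧ r • x ≠ 0 := by
  by_contra! h
  refine hx ((Submodule.span_singleton_eq_bot (R := R)).mp (hN _ (eq_bot_iff.mpr ?_)))
  rintro y ⟨hyN, hy⟩
  obtain ⟨r, rfl⟩ := Submodule.mem_span_singleton.mp hy
  exact h r hyN

/-- A submodule disjoint from `N` is contained in a maximal one. -/
theorem exists_maximal_disjoint {N S : Submodule R M} (hS : Disjoint N S) :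
    ∃ Z : Submodule R M, S ≤ Z ∧ Disjoint N Z ∧
      ∀ Z' : Submodule R M, Z ≤ Z' → Disjoint N Z' → Z' ≤ Z := by
  obtain ⟨Z, hSZ, hZ, hmax⟩ := zorn_le_nonempty₀ {K : Submodule R M | Disjoint N K} (by
    intro c hc hchain y hy
    refine ⟨sSup c, ?_, fun z hz => le_sSup hz⟩
    refine Submodule.disjoint_def.mpr fun x hxN hx => ?_
    obtain ⟨F, hF, hxF⟩ := (Submodule.mem_sSup_of_directed ⟨y, hy⟩ hchain.directedOn).mp hx
    exact Submodule.disjoint_def.mp (hc hF) x hxN hxF) S hS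
  exact ⟨Z, hSZ, hZ, fun Z' hle hZ' => hmax hZ' hle⟩

/-- If `K` misses `N ⊔ Z`, then `Z ⊔ K` still misses `N`, so maximality puts `K` inside `Z`. -/
theorem isEssentialSubmodule_sup {N Z : Submodule R M} (hZ : Disjoint N Z)
    (hmax : ∀ Z' : Submodule R M, Z ≤ Z' → Disjoint N Z' → Z' ≤ Z) :
    IsEssentialSubmodule (N ⊔ Z) := by
  intro K hK
  have hKZ : K ≤ Z := by
    refine le_sup_right.trans (hmax (Z ⊔ K) le_sup_left ?_)
    refine Submodule.disjoint_def.mpr fun x hxN hx => ?_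
    obtain ⟨z, hz, k, hk, rfl⟩ := Submodule.mem_sup.mp hx
    have hk0 : k ∈ (⊥ : Submodule R M) := by
      rw [← hK]
      refine ⟨?_, hk⟩
      have : k = (z + k) - z := by abel
      rw [this]
      exact sub_mem (Submodule.mem_sup_left hxN) (Submodule.mem_sup_right hz)
    obtain rfl : k = 0 := by simpa using hk0
    rw [add_zero] at hxN ⊢
    exact Submodule.disjoint_def.mp hZ z hxN hz
  rw [eq_bot_iff, ← hK]
  exact le_inf (hKZ.trans le_sup_right) le_rfl

end Essential

/-! ### Extending and gluing maps into an injective module -/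

section Injective

variable {R : Type u} [Ring R] {E : Type v} [AddCommGroup E] [Module R E]

theorem exists_extension_of_submodule [Module.Injective R E] (P : Submodule R E) (f : P →ₗ[R] E) :
    ∃ g : E →ₗ[R] E, ∀ x : P, g x = f x := by
  obtain ⟨g, hg⟩ := Module.Injective.out (R := R) (Q := E) P.subtype P.injective_subtype f
  exact ⟨g, hg⟩

/-- A map injective on a submodule has a one-sided inverse there. -/
theorem exists_leftInverse_on [Module.Injective R E] (P : Submodule R E) (f : E →ₗ[R] E)
    (hf : ∀ x ∈ P, f x = 0 → x = 0) : ∃ g : E →ₗ[R] E, ∀ x ∈ P, g (f x) = x := by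
  have hinj : Function.Injective (f ∘ₗ P.subtype) := by
    rw [← LinearMap.ker_eq_bot, LinearMap.ker_eq_bot']
    intro x hx
    exact Subtype.ext (hf x x.2 hx)
  obtain ⟨g, hg⟩ := Module.Injective.out (R := R) (Q := E) _ hinj P.subtype
  exact ⟨g, fun x hx => hg ⟨x, hx⟩⟩

theorem exists_glue [Module.Injective R E] {P Q : Submodule R E} (h : Disjoint P Q)
    (f g : E →ₗ[R] E) :
    ∃ k : E →ₗ[R] E, (∀ x ∈ P, k x = f x) ∧ ∀ x ∈ Q, k x = g x := by
  let s := (f.toPMap P).sup (g.toPMap Q) (LinearPMap.sup_h_of_disjoint _ _ h)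
  obtain ⟨k, hk⟩ := exists_extension_of_submodule s.domain s.toFun
  refine ⟨k, fun x hx => ?_, fun x hx => ?_⟩
  · rw [hk ⟨x, Submodule.mem_sup_left hx⟩]
    exact ((LinearPMap.left_le_sup (f.toPMap P) (g.toPMap Q)
      (LinearPMap.sup_h_of_disjoint _ _ h)).2 (x := ⟨x, hx⟩) rfl).symm
  · rw [hk ⟨x, Submodule.mem_sup_right hx⟩]
    exact ((LinearPMap.right_le_sup (f.toPMap P) (g.toPMap Q)
      (LinearPMap.sup_h_of_disjoint _ _ h)).2 (x := ⟨x, hx⟩) rfl).symm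

/-- Every submodule of an injective module is essential in a direct summand, given here as the
range of an idempotent endomorphism. -/
theorem exists_idempotent_essential [Module.Injective R E] (W : Submodule R E) :
    ∃ p : E →ₗ[R] E, (∀ x, p (p x) = p x) ∧ (∀ x ∈ W, p x = x) ∧
      ∀ x, p x = x → x ≠ 0 → ∃ r : R, r • x ∈ W ∧ r • x ≠ 0 := by
  obtain ⟨Z, -, hWZ, hZmax⟩ := exists_maximal_disjoint (disjoint_bot_right (a := W))
  obtain ⟨A, hWA, hZA, hAmax⟩ := exists_maximal_disjoint hWZ.symm
  -- `Z` is a maximal complement of `W`, and `A` a maximal complement of `Z` above `W`. Maximality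
  -- of each confines the kernel of `p` to `Z` and its range to `A`.
  obtain ⟨p, hpA, hpZ⟩ := exists_glue hZA.symm (LinearMap.id) (0 : E →ₗ[R] E)
  have hker : ∀ x, p x = 0 → x ∈ Z := by
    intro x hx
    refine hZmax (LinearMap.ker p) (fun z hz => hpZ z hz) ?_ hx
    refine Submodule.disjoint_def.mpr fun y hyW hy => ?_
    rw [← show p y = y from hpA y (hWA hyW)]
    exact hy
  have hrange : LinearMap.range p ≤ A := by
    refine hAmax _ (fun a ha => ⟨a, hpA a ha⟩) ?_
    refine Submodule.disjoint_def.mpr ?_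
    rintro _ hyZ ⟨x, rfl⟩
    have hle : Z.comap p ≤ Z := by
      refine hZmax _ (fun z hz => ?_) ?_
      · rw [Submodule.mem_comap, hpZ z hz]
        exact zero_mem _
      · refine Submodule.disjoint_def.mpr fun y hyW hy => ?_
        rw [Submodule.mem_comap, hpA y (hWA hyW)] at hy
        exact Submodule.disjoint_def.mp hWZ y hyW hy
    exact hpZ x (hle hyZ)
  refine ⟨p, fun x => hpA _ (hrange ⟨x, rfl⟩), fun x hx => hpA x (hWA hx), fun x hx hx0 => ?_⟩
  by_contra! h
  have hxA : x ∈ A := hrange ⟨x, hx⟩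
  have hxZ : x ∈ Z := by
    refine hZmax (Z ⊔ Submodule.span R {x}) le_sup_left ?_
      (Submodule.mem_sup_right (Submodule.mem_span_singleton_self x))
    refine Submodule.disjoint_def.mpr fun y hyW hy => ?_
    obtain ⟨z, hz, k, hk, rfl⟩ := Submodule.mem_sup.mp hy
    obtain ⟨r, rfl⟩ := Submodule.mem_span_singleton.mp hk
    have hzA : z ∈ A := by
      have : z = (z + r • x) - r • x := by abel
      rw [this]
      exact sub_mem (hWA hyW) (A.smul_mem r hxA)
    obtain rfl : z = 0 := Submodule.disjoint_def.mp hZA z hz hzA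
    rw [zero_add] at hyW ⊢
    exact h r hyW
  exact hx0 (Submodule.disjoint_def.mp hZA x hxZ hxA)

/-- A map that is injective on a submodule extends to a maximal such pair. -/
theorem exists_maximal_injective_extension [Module.Injective R E] (P : Submodule R E)
    (f : E →ₗ[R] E) (hf : ∀ x ∈ P, f x = 0 → x = 0) :
    ∃ (Q : Submodule R E) (g : E →ₗ[R] E), P ≤ Q ∧ (∀ x ∈ P, g x = f x) ∧
      (∀ x ∈ Q, g x = 0 → x = 0) ∧
      ∀ (Q' : Submodule R E) (g' : E →ₗ[R] E), Q ≤ Q' → (∀ x ∈ Q, g' x = g x) →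
        (∀ x ∈ Q', g' x = 0 → x = 0) → Q' ≤ Q := by
  obtain ⟨s, hs, hsinj, hmax⟩ := zorn_le_nonempty₀
    {s : E →ₗ.[R] E | ∀ x : s.domain, s x = 0 → (x : E) = 0} (by
      intro c hc hchain y hy
      refine ⟨LinearPMap.sSup c hchain.directedOn, ?_, fun z hz => LinearPMap.le_sSup _ hz⟩
      rintro ⟨x, hx⟩ hx0
      obtain ⟨t, ht, hxt⟩ := (LinearPMap.mem_domain_sSup_iff ⟨y, hy⟩ _).mp hx
      rw [LinearPMap.sSup_apply hchain.directedOn ht ⟨x, hxt⟩] at hx0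
      exact hc ht ⟨x, hxt⟩ hx0) (f.toPMap P) (fun x hx => hf x x.2 hx)
  obtain ⟨g, hg⟩ := exists_extension_of_submodule s.domain s.toFun
  refine ⟨s.domain, g, hs.1, fun x hx => ?_, fun x hx hx0 => ?_, fun Q' g' hle hg' hinj => ?_⟩
  · rw [hg ⟨x, hs.1 hx⟩]
    exact (hs.2 (x := ⟨x, hx⟩) rfl).symm
  · exact hsinj ⟨x, hx⟩ ((hg ⟨x, hx⟩).symm.trans hx0)
  · refine (hmax (y := g'.toPMap Q') (fun x hx => hinj x x.2 hx) ⟨hle, ?_⟩).1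
    rintro ⟨x, hx⟩ ⟨y, hy⟩ rfl
    exact ((hg' x hx).trans (hg ⟨x, hx⟩)).symm

end Injective

/-! ### Orbits of a submodule under an endomorphism -/

section Iterate

variable {R : Type u} [Ring R] {E : Type v} [AddCommGroup E] [Module R E]

/-- The partial sums `N + s N + ⋯ + s ^ k N`. -/
def partialOrbit (s : E →ₗ[R] E) (N : Submodule R E) : ℕ → Submodule R E
  | 0 => N
  | k + 1 => N ⊔ (partialOrbit s N k).map s

theorem partialOrbit_mono (s : E →ₗ[R] E) (N : Submodule R E) : Monotone (partialOrbit s N) := by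
  refine monotone_nat_of_le_succ fun k => ?_
  induction k with
  | zero => exact le_sup_left
  | succ k ih => exact sup_le_sup_left (Submodule.map_mono ih) N

theorem mem_iSup_partialOrbit {s : E →ₗ[R] E} {N : Submodule R E} {x : E} :
    x ∈ ⨆ k, partialOrbit s N k ↔ ∃ k, x ∈ partialOrbit s N k :=
  Submodule.mem_iSup_of_directed _ (partialOrbit_mono s N).directed_le

theorem le_iSup_partialOrbit (s : E →ₗ[R] E) (N : Submodule R E) :
    N ≤ ⨆ k, partialOrbit s N k :=
  le_iSup (partialOrbit s N) 0

theorem apply_mem_iSup_partialOrbit {s : E →ₗ[R] E} {N : Submodule R E} {x : E}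
    (hx : x ∈ ⨆ k, partialOrbit s N k) : s x ∈ ⨆ k, partialOrbit s N k := by
  obtain ⟨k, hk⟩ := mem_iSup_partialOrbit.mp hx
  exact mem_iSup_partialOrbit.mpr ⟨k + 1, Submodule.mem_sup_right ⟨x, hk, rfl⟩⟩

end Iterate

/-! ### Partial monomorphisms of a directly finite injective module -/

section DirectlyFiniteInjective

variable {R : Type u} [Ring R] {E : Type v} [AddCommGroup E] [Module R E]

/-- No nonzero submodule of `U` embeds in `L`. -/
def IsOrthogonalTo (U L : Submodule R E) : Prop :=
  ∀ (D : Submodule R E) (k : E →ₗ[R] E), D ≤ U → (∀ x ∈ D, k x ∈ L) →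
    (∀ x ∈ D, k x = 0 → x = 0) → D = ⊥

theorem IsOrthogonalTo.disjoint {U L : Submodule R E} (h : IsOrthogonalTo U L) : Disjoint U L :=
  disjoint_iff.mpr (h (U ⊓ L) LinearMap.id inf_le_left (fun _ hx => hx.2) fun _ _ hx => hx)

theorem IsOrthogonalTo.map {U L : Submodule R E} (h : IsOrthogonalTo U L) (s : E →ₗ[R] E)
    (hs : ∀ x ∈ U, s x = 0 → x = 0) : IsOrthogonalTo (U.map s) L := by
  intro D k hD hk hinj
  have h0 := h (U ⊓ D.comap s) (k ∘ₗ s) inf_le_left (fun x hx => hk _ hx.2)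
    (fun x hx hx0 => hs x hx.1 (hinj _ hx.2 hx0))
  rw [eq_bot_iff]
  intro y hy
  obtain ⟨x, hx, rfl⟩ := hD hy
  have hx0 : x ∈ (⊥ : Submodule R E) := h0 ▸ ⟨hx, hy⟩
  rw [Submodule.mem_bot] at hx0
  simp [hx0]

/-- A submodule `D` of `U ⊔ V` that embeds in `L` meets `V` trivially, so `id - p` maps it
injectively into `U`, where orthogonality applies. -/
theorem IsOrthogonalTo.sup [Module.Injective R E] {U V L : Submodule R E}
    (hU : IsOrthogonalTo U L) (hV : IsOrthogonalTo V L) (p : E →ₗ[R] E)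
    (hpU : ∀ x ∈ U, p x = 0) (hpV : ∀ x ∈ V, p x = x) : IsOrthogonalTo (U ⊔ V) L := by
  intro D k hD hk hinj
  have hDV : D ⊓ V = ⊥ := hV _ k inf_le_right (fun x hx => hk x hx.1) fun x hx => hinj x hx.1
  have hq : ∀ x ∈ D, (LinearMap.id - p : E →ₗ[R] E) x = 0 → x = 0 := by
    intro x hx hx0
    have hpx : p x = x := (sub_eq_zero.mp hx0).symm
    obtain ⟨y, hy, z, hz, rfl⟩ := Submodule.mem_sup.mp (hD hx)
    rw [map_add, hpU y hy, hpV z hz, zero_add] at hpx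
    have : y + z ∈ D ⊓ V := ⟨hx, hpx ▸ hz⟩
    rwa [hDV, Submodule.mem_bot] at this
  obtain ⟨j, hj⟩ := exists_leftInverse_on D _ hq
  have h0 := hU (D.map (LinearMap.id - p)) (k ∘ₗ j) (by
      rintro _ ⟨x, hx, rfl⟩
      obtain ⟨y, hy, z, hz, rfl⟩ := Submodule.mem_sup.mp (hD hx)
      simpa [hpU y hy, hpV z hz] using hy) (by
      rintro _ ⟨x, hx, rfl⟩
      rw [LinearMap.comp_apply, hj x hx]
      exact hk x hx) (by
      rintro _ ⟨x, hx, rfl⟩ hx0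
      rw [LinearMap.comp_apply, hj x hx] at hx0
      rw [hinj x hx hx0, map_zero])
  rw [eq_bot_iff]
  intro x hx
  have : (LinearMap.id - p : E →ₗ[R] E) x ∈ (⊥ : Submodule R E) := h0 ▸ ⟨x, hx, rfl⟩
  exact hq x hx this

/-- In an injective module whose injective endomorphisms are surjective, an endomorphism with
`s x ∈ N → x = 0` on an `s`-stable submodule containing `N` forces `N` to vanish. -/
theorem eq_bot_of_shift [Module.Injective R E]
    (hE : ∀ f : E →ₗ[R] E, Function.Injective f → Function.Surjective f)
    {W N : Submodule R E} (hNW : N ≤ W) (s : E →ₗ[R] E) (hsW : ∀ x ∈ W, s x ∈ W)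
    (hs : ∀ x ∈ W, s x ∈ N → x = 0) : N = ⊥ := by
  obtain ⟨Z, -, hWZ, hZmax⟩ := exists_maximal_disjoint (disjoint_bot_right (a := W))
  -- Extending the shift by the identity on a maximal complement of `W` gives an injective map whose
  -- range still misses `N`.
  obtain ⟨t, htW, htZ⟩ := exists_glue hWZ s LinearMap.id
  have key : ∀ x, t x ∈ N → x = 0 := by
    intro x hx
    by_contra hx0
    obtain ⟨r, hr, hr0⟩ := (isEssentialSubmodule_sup hWZ hZmax).exists_smul_mem hx0
    have htr : t (r • x) ∈ N := by
      rw [map_smul]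
      exact N.smul_mem r hx
    obtain ⟨w, hw, z, hz, hwz⟩ := Submodule.mem_sup.mp hr
    rw [← hwz] at htr hr0
    rw [map_add, htW w hw, htZ z hz, LinearMap.id_apply] at htr
    have hzW : z ∈ W := (W.add_mem_iff_right (hsW w hw)).mp (hNW htr)
    obtain rfl : z = 0 := Submodule.disjoint_def.mp hWZ z hzW hz
    rw [add_zero] at htr hr0
    exact hr0 (hs w hw htr)
  have hinj : Function.Injective t := by
    rw [← LinearMap.ker_eq_bot, LinearMap.ker_eq_bot']
    intro x hx
    exact key x (hx ▸ N.zero_mem)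
  rw [eq_bot_iff]
  intro n hn
  obtain ⟨x, rfl⟩ := hE t hinj n
  simp [key x hn]

/-- In an injective module whose injective endomorphisms are surjective, every map that is
injective on a submodule agrees there with an automorphism. -/
theorem exists_linearEquiv_eqOn [Module.Injective R E]
    (hE : ∀ f : E →ₗ[R] E, Function.Injective f → Function.Surjective f)
    (P : Submodule R E) (f : E →ₗ[R] E) (hf : ∀ x ∈ P, f x = 0 → x = 0) :
    ∃ G : E ≃ₗ[R] E, ∀ x ∈ P, G x = f x := by
  obtain ⟨Q, g, hPQ, hgf, hginj, hmax⟩ := exists_maximal_injective_extension P f hf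
  obtain ⟨p, hpp, hpQ, hpess⟩ := exists_idempotent_essential Q
  -- `g` stays injective on `range p` because `Q` is essential there, so maximality makes `Q` a
  -- direct summand.
  have hpQ' : ∀ x, p x = x → x ∈ Q := by
    intro x hx
    refine hmax (LinearMap.range p) g (fun y hy => ⟨y, hpQ y hy⟩) (fun _ _ => rfl) ?_ ⟨x, hx⟩
    rintro _ ⟨y, rfl⟩ hy
    by_contra hy0
    obtain ⟨r, hr, hr0⟩ := hpess (p y) (hpp y) hy0
    exact hr0 (hginj _ hr (by rw [map_smul, hy, smul_zero]))
  obtain ⟨j, hj⟩ := exists_leftInverse_on Q g hginj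
  let s : E →ₗ[R] E := p ∘ₗ j
  have hsg : ∀ x ∈ Q, s (g x) = x := fun x hx => by
    rw [LinearMap.comp_apply, hj x hx, hpQ x hx]
  have hps : ∀ x, p (s x) = s x := fun x => hpp _
  -- A copy in `ker s` of some `D ≤ ker p` could be glued to `g`, enlarging the maximal pair.
  have hN : IsOrthogonalTo (LinearMap.ker p) (LinearMap.ker s) := by
    intro D k hD hk hkinj
    have hQD : Disjoint Q D := Submodule.disjoint_def.mpr fun x hxQ hxD =>
      (hpQ x hxQ).symm.trans (hD hxD)
    obtain ⟨g', hg'Q, hg'D⟩ := exists_glue hQD g k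
    have hle : Q ⊔ D ≤ Q := by
      refine hmax _ g' le_sup_left hg'Q fun x hx hx0 => ?_
      obtain ⟨q, hq, d, hd, rfl⟩ := Submodule.mem_sup.mp hx
      rw [map_add, hg'Q q hq, hg'D d hd] at hx0
      have h1 := congrArg s hx0
      rw [map_add, hsg q hq, show s (k d) = 0 from hk d hd, add_zero, map_zero] at h1
      rw [h1, map_zero, zero_add] at hx0
      rw [h1, hkinj d hd hx0, add_zero]
    exact disjoint_self.mp (hQD.mono_left (le_sup_right.trans hle))
  -- Orthogonality passes from each partial orbit to its image, as `s` is injective there; the image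
  -- lies in `range p`, so it can be added to `ker p`.
  have hW : ∀ k, IsOrthogonalTo (partialOrbit s (LinearMap.ker p) k) (LinearMap.ker s) := by
    intro k
    induction k with
    | zero => exact hN
    | succ k ih =>
      refine hN.sup (ih.map s fun x hx hx0 => Submodule.disjoint_def.mp ih.disjoint x hx hx0) p
        (fun x hx => hx) ?_
      rintro _ ⟨x, -, rfl⟩
      exact hps x
  have hbot : LinearMap.ker p = ⊥ := by
    refine eq_bot_of_shift hE (le_iSup_partialOrbit s _) s
      (fun x hx => apply_mem_iSup_partialOrbit hx) fun x hx hsx => ?_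
    obtain ⟨k, hk⟩ := mem_iSup_partialOrbit.mp hx
    exact Submodule.disjoint_def.mp (hW k).disjoint x hk ((hps x).symm.trans hsx)
  have htop : ∀ x, x ∈ Q := by
    intro x
    refine hpQ' x ?_
    have : p x - x ∈ LinearMap.ker p := by simp [hpp]
    rw [hbot] at this
    exact sub_eq_zero.mp this
  have hgi : Function.Injective g := by
    rw [← LinearMap.ker_eq_bot, LinearMap.ker_eq_bot']
    exact fun x hx => hginj x (htop x) hx
  exact ⟨LinearEquiv.ofBijective g ⟨hgi, hE g hgi⟩, hgf⟩

end DirectlyFiniteInjective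

/-! ### Endomorphisms of the hull that restrict to the module -/

section Hull

variable {R : Type u} [Ring R] {M : Type v} [AddCommGroup M] [Module R M]

theorem IsDirectlyFinite.surjective_of_comp_eq_id (hM : IsDirectlyFinite R M) {s t : M →ₗ[R] M}
    (h : t ∘ₗ s = LinearMap.id) : Function.Surjective s := by
  have hts : ∀ x, t (s x) = x := fun x => LinearMap.congr_fun h x
  have hinj : Function.Injective s := fun x y hxy => by rw [← hts x, hxy, hts]
  rw [← LinearMap.range_eq_top]
  refine hM (LinearMap.range s) (LinearMap.ker t) ?_ ⟨LinearEquiv.ofInjective s hinj⟩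
  refine IsCompl.of_eq (eq_bot_iff.mpr ?_) (eq_top_iff.mpr fun x _ => ?_)
  · rintro _ ⟨⟨x, rfl⟩, hx⟩
    have hx0 : x = 0 := (hts x).symm.trans hx
    simp [hx0]
  · rw [← add_sub_cancel (s (t x)) x]
    refine Submodule.add_mem_sup ⟨_, rfl⟩ ?_
    rw [LinearMap.mem_ker, map_sub, hts, sub_self]

variable {E : Type w} [AddCommGroup E] [Module R E]

/-- The endomorphism `f` of `E` restricts to an endomorphism of `M` along `ι`. -/
def RestrictsAlong (ι : M →ₗ[R] E) (f : E →ₗ[R] E) : Prop :=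
  ∃ t : M →ₗ[R] M, ∀ m, ι (t m) = f (ι m)

namespace RestrictsAlong

variable {ι : M →ₗ[R] E} {f g : E →ₗ[R] E}

theorem id : RestrictsAlong ι LinearMap.id := ⟨LinearMap.id, fun _ => rfl⟩

theorem comp (hf : RestrictsAlong ι f) (hg : RestrictsAlong ι g) :
    RestrictsAlong ι (f ∘ₗ g) := by
  obtain ⟨s, hs⟩ := hf
  obtain ⟨t, ht⟩ := hg
  exact ⟨s ∘ₗ t, fun m => by simp [hs, ht]⟩

theorem add (hf : RestrictsAlong ι f) (hg : RestrictsAlong ι g) : RestrictsAlong ι (f + g) := by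
  obtain ⟨s, hs⟩ := hf
  obtain ⟨t, ht⟩ := hg
  exact ⟨s + t, fun m => by simp [hs, ht]⟩

theorem sub (hf : RestrictsAlong ι f) (hg : RestrictsAlong ι g) : RestrictsAlong ι (f - g) := by
  obtain ⟨s, hs⟩ := hf
  obtain ⟨t, ht⟩ := hg
  exact ⟨s - t, fun m => by simp [hs, ht]⟩

end RestrictsAlong

end Hull

/-! ### Direct finiteness passes to the injective hull -/

section AutomorphismInvariant

variable {R : Type u} [Ring R] {M : Type v} [AddCommGroup M] [Module R M]
  {E : Type (max u v)} [AddCommGroup E] [Module R E] {ι : M →ₗ[R] E}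

theorem IsAutomorphismInvariant.restrictsAlong (hM : IsAutomorphismInvariant R M)
    (hι : IsInjectiveHull ι) (g : E ≃ₗ[R] E) : RestrictsAlong ι g.toLinearMap := by
  have hmem : ∀ m, (g.toLinearMap ∘ₗ ι) m ∈ LinearMap.range ι := fun m =>
    hM E ι hι g ⟨ι m, ⟨m, rfl⟩, rfl⟩
  refine ⟨(LinearEquiv.ofInjective ι hι.injective).symm.toLinearMap ∘ₗ
    (g.toLinearMap ∘ₗ ι).codRestrict _ hmem, fun m => ?_⟩
  exact congrArg Subtype.val ((LinearEquiv.ofInjective ι hι.injective).apply_symm_apply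
    ((g.toLinearMap ∘ₗ ι).codRestrict _ hmem m))

/-- `1 + f` is an automorphism with inverse `1 - f`. -/
theorem IsAutomorphismInvariant.restrictsAlong_of_sq_zero (hM : IsAutomorphismInvariant R M)
    (hι : IsInjectiveHull ι) (f : E →ₗ[R] E) (hf : ∀ x, f (f x) = 0) : RestrictsAlong ι f := by
  let g : E ≃ₗ[R] E := LinearEquiv.ofLinearMap (LinearMap.id + f) (LinearMap.id - f)
    (by ext x; simp [hf]) (by ext x; simp [hf])
  have : f = g.toLinearMap - LinearMap.id := by
    ext x
    simp [g]
  rw [this]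
  exact (hM.restrictsAlong hι g).sub .id

/-- If `p` is an idempotent of the injective hull whose range `A` embeds by `s` in a submodule
disjoint from `A`, then every endomorphism of `A` restricts to `M`. -/
theorem IsAutomorphismInvariant.exists_idempotent_restrictsAlong
    (hM : IsAutomorphismInvariant R M) (hι : IsInjectiveHull ι) (p s : E →ₗ[R] E)
    (hpp : ∀ x, p (p x) = p x) (hs : ∀ x, p x = x → s x = 0 → x = 0)
    (hdisj : ∀ x, p x = x → p (s x) = s x → x = 0) :
    ∃ e : E →ₗ[R] E, (∀ x, p (e x) = e x) ∧ (∀ x, p x = x → e x = x) ∧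
      ∀ f : E →ₗ[R] E, RestrictsAlong ι (e ∘ₗ f ∘ₗ e) := by
  have := hι.moduleInjective
  have hd : Disjoint (LinearMap.range p) ((LinearMap.range p).map s) := by
    refine Submodule.disjoint_def.mpr ?_
    rintro _ ⟨y, hy⟩ ⟨_, ⟨x, rfl⟩, rfl⟩
    rw [hdisj (p x) (hpp x) (by rw [← hy, hpp]), map_zero]
  obtain ⟨q, hq1, hq2⟩ := exists_glue hd LinearMap.id (0 : E →ₗ[R] E)
  obtain ⟨j, hj⟩ := exists_leftInverse_on (LinearMap.range p) s (by
    rintro _ ⟨x, rfl⟩ hx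
    exact hs _ (hpp x) hx)
  obtain ⟨r, hr1, hr2⟩ := exists_glue hd (0 : E →ₗ[R] E) j
  refine ⟨p ∘ₗ q, fun x => hpp _, fun x hx => ?_, fun f => ?_⟩
  · rw [LinearMap.comp_apply, hq1 x ⟨x, hx⟩, LinearMap.id_apply, hx]
  -- With `e = p ∘ q`, the map `e f e` is the product of `e f r` and `s e`, where `r` inverts `s` on
  -- the copy of `range p`. Both square to zero, as `q` kills the copy and `r` kills `range p`.
  · have h1 : RestrictsAlong ι (s ∘ₗ p ∘ₗ q) := by
      refine hM.restrictsAlong_of_sq_zero hι _ fun x => ?_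
      have : q (s (p (q x))) = 0 := hq2 _ ⟨_, ⟨_, rfl⟩, rfl⟩
      simp [this]
    have h2 : RestrictsAlong ι ((p ∘ₗ q) ∘ₗ f ∘ₗ r) := by
      refine hM.restrictsAlong_of_sq_zero hι _ fun x => ?_
      have : r (p (q (f (r x)))) = 0 := hr1 _ ⟨_, rfl⟩
      simp [this]
    convert h2.comp h1 using 1
    ext x
    have h3 : r (s (p (q x))) = p (q x) := by
      rw [hr2 _ ⟨_, ⟨_, rfl⟩, rfl⟩, hj _ ⟨_, rfl⟩]
    simp [h3]

/-- Injective endomorphisms of the injective hull of a directly finite automorphism-invariant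
module are surjective. -/
theorem IsAutomorphismInvariant.surjective_of_injective_hull (hM : IsAutomorphismInvariant R M)
    (hι : IsInjectiveHull ι) (hfin : IsDirectlyFinite R M) (f : E →ₗ[R] E)
    (hf : Function.Injective f) : Function.Surjective f := by
  have := hι.moduleInjective
  have hf0 : ∀ x, f x = 0 → x = 0 := fun x hx => hf (hx.trans (map_zero f).symm)
  obtain ⟨τ, hτ⟩ := exists_leftInverse_on ⊤ f fun x _ hx => hf0 x hx
  replace hτ : ∀ x, τ (f x) = x := fun x => hτ x trivial
  have hK : ∀ x, τ (f x) = 0 → x = 0 := fun x hx => (hτ x).symm.trans hx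
  -- Shifting by `f ∘ f` collects only the even translates of `ker τ` in `W`; the odd ones form `f
  -- W`, a copy of `W` disjoint from it.
  let s : E →ₗ[R] E := f ∘ₗ f
  have hs0 : ∀ x, s x = 0 → x = 0 := fun x hx => hf0 _ (hf0 _ hx)
  let W : Submodule R E := ⨆ k, partialOrbit s (LinearMap.ker τ) k
  have hKW : LinearMap.ker τ ≤ W := le_iSup_partialOrbit s _
  have hsW : ∀ x ∈ W, s x ∈ W := fun x hx => apply_mem_iSup_partialOrbit hx
  -- Applying `τ` twice strips one layer from both sides of `x = f y`.
  have horbit : ∀ k, ∀ x ∈ partialOrbit s (LinearMap.ker τ) k,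
      ∀ y ∈ partialOrbit s (LinearMap.ker τ) k, x = f y → x = 0 := by
    intro k
    induction k with
    | zero =>
      rintro x hx y - rfl
      rw [hK y hx, map_zero]
    | succ k ih =>
      intro x hx y hy hxy
      obtain ⟨a, ha, _, ⟨x', hx', rfl⟩, rfl⟩ := Submodule.mem_sup.mp hx
      obtain ⟨b, hb, _, ⟨y', hy', rfl⟩, rfl⟩ := Submodule.mem_sup.mp hy
      have h1 := congrArg τ hxy
      rw [map_add, show τ a = 0 from ha, zero_add, hτ, show τ (s x') = f x' from hτ _] at h1
      have h2 := congrArg τ h1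
      rw [map_add, show τ b = 0 from hb, zero_add, hτ, show τ (s y') = f y' from hτ _] at h2
      have hx'0 : x' = 0 := ih x' hx' y' hy' h2
      have hy'0 : y' = 0 := hf0 _ (h2.symm.trans hx'0)
      rw [hx'0, hy'0, map_zero, map_zero, add_zero] at h1
      rw [hxy, ← h1, hy'0]
      simp
  have hWf : ∀ x ∈ W, f x ∈ W → x = 0 := by
    intro x hx hfx
    obtain ⟨k, hk⟩ := mem_iSup_partialOrbit.mp hx
    obtain ⟨l, hl⟩ := mem_iSup_partialOrbit.mp hfx
    exact hf0 x (horbit (max k l) _ (partialOrbit_mono _ _ (le_max_right _ _) hl) _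
      (partialOrbit_mono _ _ (le_max_left _ _) hk) rfl)
  obtain ⟨p, hpp, hpW, hpess⟩ := exists_idempotent_essential W
  obtain ⟨e, hpe, hep, he⟩ := hM.exists_idempotent_restrictsAlong hι p f hpp
    (fun x _ hx => hf0 x hx) (by
      intro x hx hfx
      by_contra hx0
      obtain ⟨r, hr, hr0⟩ := hpess (f x) hfx fun h => hx0 (hf0 x h)
      have hrx : p (r • x) = r • x := by rw [map_smul, hx]
      have hrx0 : r • x ≠ 0 := fun h => hr0 (by rw [← map_smul, h, map_zero])
      obtain ⟨r', hr', hr'0⟩ := hpess _ hrx hrx0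
      refine hr'0 (hWf _ hr' ?_)
      rw [map_smul, map_smul]
      exact W.smul_mem r' hr)
  have hee : ∀ x, e (e x) = e x := fun x => hep _ (hpe x)
  have heW : ∀ x ∈ W, e x = x := fun x hx => hep x (hpW x hx)
  have hes : ∀ x ∈ LinearMap.range p, (e ∘ₗ s) x = 0 → x = 0 := by
    rintro _ ⟨x, rfl⟩ hx
    by_contra hx0
    obtain ⟨r, hr, hr0⟩ := hpess _ (hpp x) hx0
    refine hr0 (hs0 _ ?_)
    rw [← heW _ (hsW _ hr), map_smul, map_smul, show e (s (p x)) = 0 from hx, smul_zero]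
  obtain ⟨j, hj⟩ := exists_leftInverse_on (LinearMap.range p) (e ∘ₗ s) hes
  have hje : ∀ x, j (e (s (e x))) = e x := fun x => hj (e x) ⟨e x, hpe x⟩
  have he1 : RestrictsAlong ι (LinearMap.id - e) := by
    refine RestrictsAlong.id.sub ?_
    convert he LinearMap.id using 1
    ext x
    simp [hee]
  -- On `M`, these are the shift and its left inverse on `range p`, extended by the identity on `ker
  -- e`.
  obtain ⟨σM, hσM⟩ := he1.add (he s)
  obtain ⟨τM, hτM⟩ := he1.add (he j)
  have hsurj := hfin.surjective_of_comp_eq_id (s := σM) (t := τM) (by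
    ext m
    apply hι.injective
    simp [hτM, hσM, hee, hje])
  have hbot : LinearMap.ker τ = ⊥ := by
    refine hι.essential _ (eq_bot_iff.mpr ?_)
    rintro _ ⟨⟨m, rfl⟩, hm⟩
    obtain ⟨m', rfl⟩ := hsurj m
    have heq : ι (σM m') = ι m' - e (ι m') + e (s (e (ι m'))) := by simpa using hσM m'
    have h1 : e (ι (σM m')) = ι (σM m') := heW _ (hKW hm)
    have h2 : ι (σM m') = e (s (e (ι m'))) := by
      rw [← h1, heq]
      simp [hee]
    -- A nonzero multiple of `e (ι m')` in `W` would be shifted by `s` into `ker τ`, which meets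
    -- `range f` trivially.
    have h3 : e (ι m') = 0 := by
      by_contra h0
      obtain ⟨r, hr, hr0⟩ := hpess _ (hpe _) h0
      have h4 : r • ι (σM m') = s (r • e (ι m')) := by
        rw [← heW _ (hsW _ hr), map_smul, map_smul, h2]
      have h5 : τ (s (r • e (ι m'))) = 0 := by
        rw [← h4, map_smul, show τ (ι (σM m')) = 0 from hm, smul_zero]
      exact hr0 (hf0 _ (hK _ h5))
    rw [Submodule.mem_bot, h2, h3]
    simp
  intro x
  refine ⟨τ x, ?_⟩
  have : f (τ x) - x ∈ LinearMap.ker τ := by simp [hτ]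
  rw [hbot] at this
  exact sub_eq_zero.mp this

end AutomorphismInvariant

/-! ### Stable range one for the endomorphism ring -/

section StableRange

variable {R : Type u} [Ring R] {M : Type v} [AddCommGroup M] [Module R M]

/-- In a directly finite automorphism-invariant module, every endomorphism that is injective on a
submodule agrees there with an automorphism. -/
theorem IsAutomorphismInvariant.exists_linearEquiv_eqOn (hM : IsAutomorphismInvariant R M)
    (hfin : IsDirectlyFinite R M) (P : Submodule R M) (f : M →ₗ[R] M)
    (hf : ∀ x ∈ P, f x = 0 → x = 0) : ∃ g : M ≃ₗ[R] M, ∀ x ∈ P, g x = f x := by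
  obtain ⟨E, _, _, ι, hι⟩ := exists_isInjectiveHull R M
  have := hι.moduleInjective
  let c := Submodule.equivMapOfInjective ι hι.injective P
  obtain ⟨φ, hφ⟩ := exists_extension_of_submodule (P.map ι)
    (ι ∘ₗ f ∘ₗ P.subtype ∘ₗ c.symm.toLinearMap)
  replace hφ : ∀ x ∈ P, φ (ι x) = ι (f x) := by
    intro x hx
    have h := hφ (c ⟨x, hx⟩)
    simpa [c] using h
  obtain ⟨G, hG⟩ := _root_.exists_linearEquiv_eqOn
    (hM.surjective_of_injective_hull hι hfin) (P.map ι) φ (by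
      rintro _ ⟨x, hx, rfl⟩ hx0
      rw [hφ x hx] at hx0
      rw [hf x hx (hι.injective (hx0.trans (map_zero ι).symm)), map_zero])
  obtain ⟨s, hs⟩ := hM.restrictsAlong hι G
  obtain ⟨t, ht⟩ := hM.restrictsAlong hι G.symm
  refine ⟨LinearEquiv.ofLinearMap s t ?_ ?_, fun x hx => hι.injective ?_⟩
  · ext m
    apply hι.injective
    simp [hs, ht]
  · ext m
    apply hι.injective
    simp [hs, ht]
  · exact (hs x).trans ((hG _ ⟨x, hx, rfl⟩).trans (hφ x hx))

theorem IsAutomorphismInvariant.bijective_of_injective (hM : IsAutomorphismInvariant R M)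
    (hfin : IsDirectlyFinite R M) (f : M →ₗ[R] M) (hf : ∀ x, f x = 0 → x = 0) :
    Function.Bijective f := by
  obtain ⟨g, hg⟩ := hM.exists_linearEquiv_eqOn hfin ⊤ f fun x _ hx => hf x hx
  have : ⇑f = g := funext fun x => (hg x trivial).symm
  rw [this]
  exact g.bijective

/-- The endomorphism ring of a directly finite automorphism-invariant module has stable range
one. -/
theorem IsAutomorphismInvariant.exists_bijective_add_comp (hM : IsAutomorphismInvariant R M)
    (hfin : IsDirectlyFinite R M) (f b : M →ₗ[R] M) :
    ∃ t : M →ₗ[R] M, Function.Bijective (f + (LinearMap.id - f ∘ₗ b) ∘ₗ t : M →ₗ[R] M) := by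
  obtain ⟨P, -, hP, hPmax⟩ := exists_maximal_disjoint (disjoint_bot_right (a := LinearMap.ker f))
  have hess := isEssentialSubmodule_sup hP hPmax
  obtain ⟨g, hg⟩ := hM.exists_linearEquiv_eqOn hfin P f fun x hx hx0 =>
    Submodule.disjoint_def.mp hP x hx0 hx
  have hg0 : ∀ x, g x = 0 → x = 0 := fun x hx => by simpa using hx
  -- This `t` vanishes on `P` and equals `g` on `ker f`. Injectivity need only be tested on the
  -- essential submodule `ker f ⊔ P`.
  refine ⟨g.toLinearMap - f, hM.bijective_of_injective hfin _ fun x hx => ?_⟩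
  by_contra hx0
  obtain ⟨r, hr, hr0⟩ := hess.exists_smul_mem hx0
  obtain ⟨y, hy, z, hz, hyz⟩ := Submodule.mem_sup.mp hr
  replace hy : f y = 0 := hy
  have hmain : f z + g y = f (b (g y)) := by
    have h := congrArg (r • ·) hx
    simp only [← map_smul, ← hyz, smul_zero] at h
    simp [hy, hg z hz] at h
    rw [← add_sub_assoc, sub_eq_zero] at h
    exact h
  -- Otherwise a nonzero multiple of `b (g y)` splits as `y' + z'`. Applying `f` and cancelling `g`
  -- puts `r' • y` in `P ⊓ ker f`, so that multiple vanishes.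
  have hb : b (g y) = 0 := by
    by_contra hb0
    obtain ⟨r', hr', hr'0⟩ := hess.exists_smul_mem hb0
    obtain ⟨y', hy', z', hz', hyz'⟩ := Submodule.mem_sup.mp hr'
    have h1 : r' • f z + r' • g y = f z' := by
      rw [← smul_add, hmain, ← map_smul, ← hyz', map_add, show f y' = 0 from hy', zero_add]
    rw [← hg z hz, ← hg z' hz', ← map_smul, ← map_smul, ← map_add] at h1
    have h2 : r' • z + r' • y = z' := g.injective h1
    have h3 : r' • y ∈ P := by
      rw [← eq_sub_iff_add_eq'] at h2
      rw [h2]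
      exact sub_mem hz' (P.smul_mem r' hz)
    have h4 : r' • y = 0 := Submodule.disjoint_def.mp hP _
      ((LinearMap.ker f).smul_mem r' hy) h3
    exact hr'0 (by rw [← map_smul, ← map_smul, h4, map_zero, map_zero])
  rw [hb, map_zero, ← hg z hz, ← map_add] at hmain
  exact hr0 (by rw [← hyz, add_comm, hg0 _ hmain])

end StableRange

/-! ### From stable range one to substitution, cancellation and direct finiteness -/

section Substitution

variable {R : Type u} [Ring R] {M : Type v} [AddCommGroup M] [Module R M]
  {X : Type w} [AddCommGroup X] [Module R X]

theorem exists_splitting_of_isCompl {A H : Submodule R X} (h : IsCompl A H) (e : A ≃ₗ[R] M) :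
    ∃ (i : M →ₗ[R] X) (p : X →ₗ[R] M), (∀ m, p (i m) = m) ∧ LinearMap.ker p = H := by
  refine ⟨A.subtype ∘ₗ e.symm.toLinearMap, e.toLinearMap ∘ₗ A.projectionOnto H h,
    fun m => ?_, ?_⟩
  · simp
  · rw [LinearEquiv.ker_comp, Submodule.ker_projectionOnto]

theorem isCompl_range_ker_of_bijective {j : M →ₗ[R] X} {p : X →ₗ[R] M}
    (h : Function.Bijective (p ∘ₗ j)) : IsCompl (LinearMap.range j) (LinearMap.ker p) := by
  refine IsCompl.of_eq (eq_bot_iff.mpr ?_) (eq_top_iff.mpr fun x _ => ?_)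
  · rintro _ ⟨⟨m, rfl⟩, hm⟩
    have : m = 0 := h.1 ((show (p ∘ₗ j) m = 0 from hm).trans (map_zero _).symm)
    simp [this]
  · obtain ⟨m, hm⟩ := h.2 (p x)
    rw [← add_sub_cancel (j m) x]
    refine Submodule.add_mem_sup ⟨m, rfl⟩ ?_
    rw [LinearMap.mem_ker, map_sub, ← hm, LinearMap.comp_apply, sub_self]

theorem hasSubstitution_of_stableRange
    (h : ∀ f b : M →ₗ[R] M,
      ∃ t : M →ₗ[R] M, Function.Bijective (f + (LinearMap.id - f ∘ₗ b) ∘ₗ t : M →ₗ[R] M)) :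
    HasSubstitution.{u, v, w} R M := by
  rintro X _ _ A₁ H A₂ K h₁ h₂ ⟨e₁⟩ ⟨e₂⟩
  obtain ⟨i, p, hpi, rfl⟩ := exists_splitting_of_isCompl h₁ e₁
  obtain ⟨i', p', hpi', rfl⟩ := exists_splitting_of_isCompl h₂ e₂
  obtain ⟨t, ht⟩ := h (p' ∘ₗ i) (p ∘ₗ i')
  -- Composing this map with `p` gives the identity, since `id - i p` lands in `ker p`; composing
  -- with `p'` gives `f + (1 - f b) t` for `f = p' i` and `b = p i'`.
  refine ⟨LinearMap.range (i + (LinearMap.id - i ∘ₗ p) ∘ₗ i' ∘ₗ t),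
    isCompl_range_ker_of_bijective ?_, isCompl_range_ker_of_bijective ?_⟩
  · convert Function.bijective_id (α := M)
    ext m
    simp [hpi]
  · convert ht using 2
    ext m
    simp [hpi']

/-- In `M × A`, both `A` and the transported `B` are complements of the same `C`, hence both are
isomorphic to the quotient by `C`. -/
theorem HasSubstitution.hasCancellation (h : HasSubstitution.{u, v, w} R M) :
    HasCancellation.{u, v, w} R M := by
  rintro A B _ _ _ _ ⟨e⟩
  let pA : M × A →ₗ[R] M := LinearMap.fst R M A
  let pB : M × A →ₗ[R] M := LinearMap.fst R M B ∘ₗ e.toLinearMap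
  let iB : M →ₗ[R] M × A := e.symm.toLinearMap ∘ₗ LinearMap.inl R M B
  have hA : pA ∘ₗ LinearMap.inl R M A = LinearMap.id := by ext; simp [pA]
  have hB : pB ∘ₗ iB = LinearMap.id := by ext; simp [pB, iB]
  have hiB : Function.Injective iB := e.symm.injective.comp LinearMap.inl_injective
  obtain ⟨C, hCA, hCB⟩ := h (M × A) _ (LinearMap.ker pA) _ (LinearMap.ker pB)
    (isCompl_range_ker_of_bijective (hA ▸ Function.bijective_id))
    (isCompl_range_ker_of_bijective (hB ▸ Function.bijective_id))
    ⟨(LinearEquiv.ofInjective _ LinearMap.inl_injective).symm⟩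
    ⟨(LinearEquiv.ofInjective iB hiB).symm⟩
  have eA : A ≃ₗ[R] LinearMap.ker pA :=
    (LinearEquiv.ofInjective (LinearMap.inr R M A) LinearMap.inr_injective).trans
      (LinearEquiv.ofEq _ _ (LinearMap.ker_fst R M A).symm)
  have eB : B ≃ₗ[R] LinearMap.ker pB := by
    refine (LinearEquiv.ofInjective (e.symm.toLinearMap ∘ₗ LinearMap.inr R M B)
      (e.symm.injective.comp LinearMap.inr_injective)).trans (LinearEquiv.ofEq _ _ ?_)
    ext x
    constructor
    · rintro ⟨b, rfl⟩
      simp [pB]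
    · intro hx
      refine ⟨(e x).2, ?_⟩
      have hx1 : (e x).1 = 0 := hx
      apply e.injective
      ext <;> simp [hx1]
  exact ⟨eA ≪≫ₗ (Submodule.quotientEquivOfIsCompl C _ hCA).symm ≪≫ₗ
    Submodule.quotientEquivOfIsCompl C _ hCB ≪≫ₗ eB.symm⟩

/-- Both `M ⊕ B₁` and `M ⊕ B₂` are isomorphic to `A₁ ⊕ B₁ ⊕ B₂`, so `M` cancels. `ULift` only
adjusts universes. -/
theorem HasCancellation.hasInternalCancellation (h : HasCancellation.{u, v, w} R M) :
    HasInternalCancellation R M := by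
  rintro A₁ B₁ hc A₂ B₂ _ _ _ _ ⟨e⟩ ⟨a⟩
  let e₁ : M ≃ₗ[R] A₁ × B₁ := (Submodule.prodEquivOfIsCompl A₁ B₁ hc).symm
  let u₁ : ULift.{w} B₁ ≃ₗ[R] B₁ := ULift.moduleEquiv
  let u₂ : ULift.{w} B₂ ≃ₗ[R] B₂ := ULift.moduleEquiv
  have c : (M × ULift.{w} B₁) ≃ₗ[R] (M × ULift.{w} B₂) :=
    (LinearEquiv.prodCongr e u₁) ≪≫ₗ
      (LinearEquiv.prodAssoc R A₂ B₂ B₁) ≪≫ₗ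
      (LinearEquiv.prodCongr a.symm (LinearEquiv.prodComm R B₂ B₁)) ≪≫ₗ
      (LinearEquiv.prodAssoc R A₁ B₁ B₂).symm ≪≫ₗ
      (LinearEquiv.prodCongr e₁.symm u₂.symm)
  obtain ⟨d⟩ := h _ _ ⟨c⟩
  exact ⟨u₁.symm ≪≫ₗ d ≪≫ₗ u₂⟩

theorem HasInternalCancellation.isDirectlyFinite (h : HasInternalCancellation R M) :
    IsDirectlyFinite R M := by
  rintro N K hc ⟨e⟩
  obtain ⟨k⟩ := h N K hc M PUnit ⟨LinearEquiv.prodUnique.symm⟩ ⟨e.symm⟩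
  have hK : K = ⊥ := (Submodule.subsingleton_iff_eq_bot).mp k.toEquiv.subsingleton
  rw [hK] at hc
  simpa using hc.sup_eq_top

end Substitution

theorem mainTheorem3 {R : Type u} [Ring R] {M : Type v} [AddCommGroup M] [Module R M]
    (hM : IsAutomorphismInvariant R M) :
    [IsDirectlyFinite R M,
      HasInternalCancellation R M,
      HasCancellation.{u, v, w} R M,
      HasSubstitution.{u, v, w} R M].TFAE := by
  tfae_have 1 → 4 := fun h =>
    hasSubstitution_of_stableRange fun f b => hM.exists_bijective_add_comp h f b
  tfae_have 4 → 3 := fun h => h.hasCancellation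
  tfae_have 3 → 2 := fun h => h.hasInternalCancellation
  tfae_have 2 → 1 := fun h => h.isDirectlyFinite
  tfae_finish
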